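/- Let $\mathbb P$ be a partition of the sure event $\Omega$ (finite or infinite) and let $\mathcal A$ be the set of all events logically dependent on $\mathbb P$, i.e. the power set of $\mathbb P$. Let $P_0$ be a finitely additive probability on $\mathcal A$ and let $0<\varepsilon<1$. The $\varepsilon$-contamination model is the pair of conjugate lower and upper probabilities $$\underline P_\varepsilon(A)=(1-\varepsilon)P_0(A)\ (A\neq\Omega),\quad \underline P_\varepsilon(\Omega)=1,\qquad \overline P_\varepsilon(A)=(1-\varepsilon)P_0(A)+\varepsilon\ (A\neq\emptyset),\quad \overline P_\varepsilon(\emptyset)=0 .$$ A lower probability $Q$ on a set $\mathcal D$ of conditional events is coherent in the sense of Williams if for all $n$, all $A_0|B_0,\dots,A_n|B_n\in\mathcal D$ and all $s_0,\dots,s_n\ge 0$, the gain $G=\sum_{i=1}^n s_i 1_{B_i}\bigl(1_{A_i}-Q(A_i|B_i)\bigr)-s_0 1_{B_0}\bigl(1_{A_0}-Q(A_0|B_0)\bigr)$ satisfies $\sup_S G\ge 0$, where $S=\bigcup\{B_i: s_i\ne 0\}$, whenever $S\neq\emptyset$. For a non-empty event $B\in\mathcal A$, let $\underline E(\cdot|B)$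 be the natural extension of $\underline P_\varepsilon$, i.e. its smallest Williams-coherent extension to $\mathcal A\cup\{C|B: C\in\mathcal A\}$, and let $\overline E(C|B)=1-\underline E(\neg C|B)$. Let $\mathfrak B\subset\mathcal A\setminus\{\emptyset\}$ be a partition of $\Omega$, and let $A\in\mathcal A$ be non-extreme (neither $\underline P_\varepsilon(A)=\overline P_\varepsilon(A)=0$ nor $\underline P_\varepsilon(A)=\overline P_\varepsilon(A)=1$) and logically independent of $\mathfrak B$ (for no $B\in\mathfrak B$ does $B$ imply $A$ or $\neg A$). Suppose that $P_0(A\wedge B)>0$ and $P_0(\neg A\wedge B)>0$ for all $B\in\mathfrak B$. Then $\mathfrak B$ weakly dilates $A$, that is, $$\underline E(A|B)\le\underline P_\varepsilon(A)\le\overline P_\varepsilon(A)\le\overline E(A|B)\quad\text{for all }B\in\mathfrak B,$$ if and only if, for all $B\in\mathfrak B$, $$-\varepsilon P_0(\neg A)P_0(\neg B)\le P_0(A\wedge B)-P_0(A)P_0(B)\le\varepsilon P_0(A)P_0(\neg B).$$ -/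

import Mathlib

/-!
The points of `Ω` are the atoms of the reference partition, so that events are the subsets of `Ω`.
-/

namespace Dilation

/-- A (precise) probability on the set of all events: a finitely additive probability. -/
structure FinAddProb (Ω : Type*) where
  toFun : Set Ω → ℝ
  nonneg' : ∀ A, 0 ≤ toFun A
  univ' : toFun Set.univ = 1
  union' : ∀ A B, Disjoint A B → toFun (A ∪ B) = toFun A + toFun B

instance {Ω : Type*} : CoeFun (FinAddProb Ω) (fun _ => Set Ω → ℝ) := ⟨FinAddProb.toFun⟩

/-- A conditional event `event | cond`. -/
structure CondEvent (Ω : Type*) where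
  event : Set Ω
  cond : Set Ω

/-- The unconditional events, an event `A` being identified with `A | Ω`. -/
def unconditional (Ω : Type*) : Set (CondEvent Ω) := {X | X.cond = Set.univ}

/-- The conditional events `A | B` with the given conditioning event `B`. -/
def givenEvent {Ω : Type*} (B : Set Ω) : Set (CondEvent Ω) := {X | X.cond = B}

/-- The gain, as a function of the true atom, of a unit bet on the conditional event `X` at price
`p`: it is `1 - p` or `-p` as the event is true or false, and `0` (bet called off) when the
conditioning event is false. -/
noncomputable def gain {Ω : Type*} (X : CondEvent Ω) (p : ℝ) (ω : Ω) : ℝ :=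
  X.cond.indicator 1 ω * (X.event.indicator 1 ω - p)

/-- Williams coherence of a lower probability `L` on an arbitrary set `D` of conditional events
(the values of `L` outside `D` play no role): no finite combination of bets in favour of
`X 0, …, X (n - 1)` with stakes `s i ≥ 0` and one bet against `X₀` with stake `s₀ ≥ 0` has a gain
whose supremum, conditional on at least one of the bets with non-zero stake not being called off,
is negative. -/
def WCoherent {Ω : Type*} (D : Set (CondEvent Ω)) (L : CondEvent Ω → ℝ) : Prop :=
  ∀ (n : ℕ) (X : Fin n → CondEvent Ω) (X₀ : CondEvent Ω) (s : Fin n → ℝ) (s₀ : ℝ),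
    (∀ i, X i ∈ D) → X₀ ∈ D → (∀ i, 0 ≤ s i) → 0 ≤ s₀ →
    let S : Set Ω := {ω | (∃ i, s i ≠ 0 ∧ ω ∈ (X i).cond) ∨ (s₀ ≠ 0 ∧ ω ∈ X₀.cond)}
    let G : Ω → ℝ := fun ω => ∑ i, s i * gain (X i) (L (X i)) ω - s₀ * gain X₀ (L X₀) ω
    S.Nonempty → 0 ≤ sSup (G '' S)

/-- `Q` is a Williams-coherent extension, to the unconditional events and to the events conditional
on `B`, of the lower probability `L` given on the unconditional events. -/
def IsCoherentExtension {Ω : Type*} (L : Set Ω → ℝ) (B : Set Ω) (Q : CondEvent Ω → ℝ) : Prop :=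
  WCoherent (unconditional Ω ∪ givenEvent B) Q ∧ ∀ A : Set Ω, Q ⟨A, Set.univ⟩ = L A

/-- `E` is the natural extension of `L` to the unconditional events and to the events conditional
on `B`: the least-committal (pointwise smallest) Williams-coherent extension. It is uniquely
determined on these events. -/
def IsNaturalExtension {Ω : Type*} (L : Set Ω → ℝ) (B : Set Ω) (E : CondEvent Ω → ℝ) : Prop :=
  IsCoherentExtension L B E ∧
    ∀ Q, IsCoherentExtension L B Q → ∀ X ∈ unconditional Ω ∪ givenEvent B, E X ≤ Q X

/-- The family `𝔅` weakly dilates the event `A`, for conjugate lower and upper probabilities `L`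
and `U`. For each `B`, `E ⟨A, B⟩` is the natural extension of `L` at `A | B`, and the natural
extension of `U` at `A | B` is its conjugate `1 - E ⟨Aᶜ, B⟩`. -/
def WeaklyDilates {Ω : Type*} (L U : Set Ω → ℝ) (𝔅 : Set (Set Ω)) (A : Set Ω) : Prop :=
  ∀ B ∈ 𝔅, ∃ E : CondEvent Ω → ℝ, IsNaturalExtension L B E ∧
    E ⟨A, B⟩ ≤ L A ∧ L A ≤ U A ∧ U A ≤ 1 - E ⟨Aᶜ, B⟩

/-- `A` is logically independent of `𝔅`. -/
def LogicallyIndependent {Ω : Type*} (A : Set Ω) (𝔅 : Set (Set Ω)) : Prop :=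
  ∀ B ∈ 𝔅, ¬ B ⊆ A ∧ ¬ B ⊆ Aᶜ

/-- `A` is extreme for the lower and upper probabilities `L` and `U`. -/
def IsExtreme {Ω : Type*} (L U : Set Ω → ℝ) (A : Set Ω) : Prop :=
  (L A = 0 ∧ U A = 0) ∨ (L A = 1 ∧ U A = 1)

open Classical in
/-- The lower probability of the `ε`-contamination model of `P₀`. -/
noncomputable def contaminationLower {Ω : Type*} (P₀ : FinAddProb Ω) (ε : ℝ) (A : Set Ω) : ℝ :=
  if A = Set.univ then 1 else (1 - ε) * P₀ A

open Classical in
/-- The upper probability of the `ε`-contamination model of `P₀`. -/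
noncomputable def contaminationUpper {Ω : Type*} (P₀ : FinAddProb Ω) (ε : ℝ) (A : Set Ω) : ℝ :=
  if A = ∅ then 0 else (1 - ε) * P₀ A + ε

end Dilation

namespace Dilation

namespace FinAddProb

variable {Ω : Type*}

/-! When `P₀ B > 0`, the natural extension has a closed form: at `C | B` it is `(1 - ε) P₀(C ∩ B) /
((1 - ε) P₀ B + ε)`, or `1` if `B ⊆ C`. It is coherent because it is the attained lower envelope of
the conditional probabilities of the mixtures of `P₀` with point masses (`wCoherent_of_envelope`).
It is minimal because a combination of three bets with constant gain forces every coherent extension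
above it (`WCoherent.le_mul_add`). Cancelling `1 - ε` in the comparison of this formula with the
lower probability of `A` gives the right-hand inequality. The same comparison for `Aᶜ` gives the
left-hand one, by conjugacy. -/

theorem empty (P : FinAddProb Ω) : P ∅ = 0 := by
  have h := P.union' ∅ ∅ disjoint_bot_left
  rw [Set.union_self] at h
  linarith

theorem mono (P : FinAddProb Ω) {A B : Set Ω} (h : A ⊆ B) : P A ≤ P B := by
  have h1 := P.union' A (B \ A) Set.disjoint_sdiff_right
  rw [Set.union_sdiff_cancel h] at h1
  linarith [P.nonneg' (B \ A)]

theorem compl (P : FinAddProb Ω) (A : Set Ω) : P Aᶜ = 1 - P A := by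
  have h := P.union' A Aᶜ disjoint_compl_right
  rw [Set.union_compl_self, P.univ'] at h
  linarith

theorem inter_add_compl_inter (P : FinAddProb Ω) (A B : Set Ω) :
    P (A ∩ B) + P (Aᶜ ∩ B) = P B := by
  rw [← P.union' (A ∩ B) (Aᶜ ∩ B)
    (disjoint_compl_right.mono Set.inter_subset_left Set.inter_subset_left),
    ← Set.union_inter_distrib_right, Set.union_compl_self, Set.univ_inter]

theorem biUnion (P : FinAddProb Ω) {ι : Type*} [DecidableEq ι] (t : Finset ι) (A : ι → Set Ω)
    (hA : Pairwise (Function.onFun Disjoint A)) :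
    P (⋃ i ∈ t, A i) = ∑ i ∈ t, P (A i) := by
  induction t using Finset.induction_on with
  | empty => simp [P.empty]
  | insert a t ha ih =>
    rw [Finset.set_biUnion_insert, P.union', ih, Finset.sum_insert ha]
    simp only [Set.disjoint_iUnion_right]
    intro i hi
    exact hA (fun h => ha (h ▸ hi))

/-- The simple function with the given coefficients on the indicators of events. -/
noncomputable def simple (Ω : Type*) : (Set Ω →₀ ℝ) →ₗ[ℝ] (Ω → ℝ) :=
  Finsupp.linearCombination ℝ fun A => A.indicator 1

/-- The expectation of the simple function with the given coefficients. -/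
noncomputable def expect (P : FinAddProb Ω) : (Set Ω →₀ ℝ) →ₗ[ℝ] ℝ :=
  Finsupp.linearCombination ℝ fun A => P A

open Classical in
/-- The expectation of a simple function is monotone (and thus depends only on the function). -/
theorem expect_nonpos (P : FinAddProb Ω) (c : Set Ω →₀ ℝ) (hc : ∀ ω, simple Ω c ω ≤ 0) :
    P.expect c ≤ 0 := by
  -- The fibres of `f` are the atoms generated by the finitely many events of the support; the
  -- simple function is constant on each.
  let f : Ω → Finset (Set Ω) := fun ω => c.support.filter fun A => ω ∈ A
  let F : Finset (Set Ω) → Set Ω := fun x => f ⁻¹' {x}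
  have hF : Pairwise (Function.onFun Disjoint F) := fun x y hxy =>
    Disjoint.preimage f (Set.disjoint_singleton.2 hxy)
  have hA : ∀ A ∈ c.support,
      P A = ∑ x ∈ c.support.powerset, if A ∈ x then P (F x) else 0 := by
    intro A hAc
    rw [← Finset.sum_filter, ← P.biUnion _ _ hF]
    congr 1
    ext ω
    simp only [Set.mem_iUnion, F, Set.mem_preimage, Set.mem_singleton_iff, Finset.mem_filter,
      exists_prop, exists_eq_right', Finset.mem_powerset, f]
    exact ⟨fun h => ⟨Finset.filter_subset _ _, hAc, h⟩, fun h => h.2.2⟩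
  have hsum : P.expect c = ∑ x ∈ c.support.powerset, (∑ A ∈ x, c A) * P (F x) := by
    rw [expect, Finsupp.linearCombination_apply, Finsupp.sum,
      Finset.sum_congr rfl fun A hAc => by rw [hA A hAc, Finset.smul_sum], Finset.sum_comm]
    refine Finset.sum_congr rfl fun x hx => ?_
    simp only [smul_eq_mul, mul_ite, mul_zero]
    rw [← Finset.sum_filter, Finset.sum_mul]
    congr 1
    rw [Finset.filter_mem_eq_inter, Finset.inter_eq_right.2 (Finset.mem_powerset.1 hx)]
  rw [hsum]
  refine Finset.sum_nonpos fun x _ => ?_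
  rcases (F x).eq_empty_or_nonempty with h | ⟨ω, hω⟩
  · rw [h, P.empty, mul_zero]
  · refine mul_nonpos_of_nonpos_of_nonneg ?_ (P.nonneg' _)
    have hx : f ω = x := hω
    have := hc ω
    rw [simple, Finsupp.linearCombination_apply, Finsupp.sum, Finset.sum_apply] at this
    rw [← hx]
    simpa [f, Finset.sum_filter, Set.indicator_apply] using this

/-- The mixture of a probability and the point mass at `ω`. -/
noncomputable def mixDirac (P : FinAddProb Ω) (ε : ℝ) (hε₀ : 0 ≤ ε) (hε₁ : ε ≤ 1) (ω : Ω) :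
    FinAddProb Ω where
  toFun A := (1 - ε) * P A + ε * A.indicator 1 ω
  nonneg' A := add_nonneg (mul_nonneg (by linarith) (P.nonneg' A))
    (mul_nonneg hε₀ (Set.indicator_nonneg (fun _ _ => zero_le_one) ω))
  univ' := by simp [P.univ']
  union' A B h := by
    rw [P.union' A B h, Set.indicator_union_of_disjoint h]
    ring

theorem mixDirac_apply (P : FinAddProb Ω) (ε : ℝ) (hε₀ : 0 ≤ ε) (hε₁ : ε ≤ 1) (ω : Ω)
    (A : Set Ω) :
    P.mixDirac ε hε₀ hε₁ ω A = (1 - ε) * P A + ε * A.indicator 1 ω := rfl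

end FinAddProb

variable {Ω : Type*}

/-! ### Coherence of attained lower envelopes -/

/-- The coefficients of the gain of a unit bet as a simple function. -/
noncomputable def gainCoeff (X : CondEvent Ω) (p : ℝ) : Set Ω →₀ ℝ :=
  Finsupp.single (X.event ∩ X.cond) 1 - Finsupp.single X.cond p

theorem simple_gainCoeff (X : CondEvent Ω) (p : ℝ) :
    FinAddProb.simple Ω (gainCoeff X p) = gain X p := by
  classical
  ext ω
  by_cases h1 : ω ∈ X.cond <;> by_cases h2 : ω ∈ X.event <;>
    simp [FinAddProb.simple, gainCoeff, gain, h1, h2]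

theorem expect_gainCoeff (P : FinAddProb Ω) (X : CondEvent Ω) (p : ℝ) :
    P.expect (gainCoeff X p) = P (X.event ∩ X.cond) - p * P X.cond := by
  simp [FinAddProb.expect, gainCoeff]

theorem abs_gain_le (X : CondEvent Ω) (p : ℝ) (ω : Ω) : |gain X p ω| ≤ 1 + |p| := by
  classical
  have h3 := abs_sub (1 : ℝ) p
  rw [abs_one] at h3
  have := abs_nonneg p
  by_cases h1 : ω ∈ X.cond <;> by_cases h2 : ω ∈ X.event <;> simp [gain, h1, h2] <;> linarith

/-- A lower probability whose value at each conditional event is attained by some dominating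
probability, positive on all conditioning events, is Williams coherent. -/
theorem wCoherent_of_envelope {D : Set (CondEvent Ω)} {L : CondEvent Ω → ℝ}
    (h : ∀ X₀ ∈ D, ∃ P : FinAddProb Ω, (∀ X ∈ D, 0 < P X.cond) ∧
      (∀ X ∈ D, L X * P X.cond ≤ P (X.event ∩ X.cond)) ∧
      P (X₀.event ∩ X₀.cond) = L X₀ * P X₀.cond) : WCoherent D L := by
  intro n X X₀ s s₀ hX hX₀ hs hs₀ S G hS
  obtain ⟨P, hpos, hle, heq⟩ := h X₀ hX₀
  by_contra! hneg
  have hbdd : BddAbove (G '' S) := by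
    refine ⟨∑ i, s i * (1 + |L (X i)|) + s₀ * (1 + |L X₀|), ?_⟩
    rintro _ ⟨ω, -, rfl⟩
    have h1 : ∑ i, s i * gain (X i) (L (X i)) ω ≤ ∑ i, s i * (1 + |L (X i)|) :=
      Finset.sum_le_sum fun i _ =>
        mul_le_mul_of_nonneg_left ((le_abs_self _).trans (abs_gain_le _ _ _)) (hs i)
    have h2 := mul_le_mul_of_nonneg_left ((neg_le_abs _).trans (abs_gain_le X₀ (L X₀) ω)) hs₀
    simp only [G]
    linarith
  set δ := sSup (G '' S)
  -- This represents `G - δ 1_S`, which is nowhere positive since `G` vanishes off `S`. Its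
  -- expectation is at least `-δ P(S) > 0` if `δ < 0`: a contradiction.
  let c : Set Ω →₀ ℝ := ∑ i, s i • gainCoeff (X i) (L (X i)) - s₀ • gainCoeff X₀ (L X₀)
    - Finsupp.single S δ
  have hc : ∀ ω, FinAddProb.simple Ω c ω = G ω - δ * S.indicator 1 ω := by
    intro ω
    simp only [c, map_sub, map_sum, map_smul, simple_gainCoeff]
    simp [FinAddProb.simple, G, Finset.sum_apply]
  have hnp : ∀ ω, FinAddProb.simple Ω c ω ≤ 0 := by
    intro ω
    rw [hc]
    by_cases hω : ω ∈ S
    · have := le_csSup hbdd ⟨ω, hω, rfl⟩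
      simpa [hω] using this
    · have h0 : G ω = 0 := by
        have hω' : (∀ i, s i ≠ 0 → ω ∉ (X i).cond) ∧ (s₀ ≠ 0 → ω ∉ X₀.cond) := by
          simpa [S, not_or] using hω
        have h1 : ∀ i, s i * gain (X i) (L (X i)) ω = 0 := by
          intro i
          by_cases hi : s i = 0
          · simp [hi]
          · simp [gain, hω'.1 i hi]
        have h2 : s₀ * gain X₀ (L X₀) ω = 0 := by
          by_cases hi : s₀ = 0
          · simp [hi]
          · simp [gain, hω'.2 hi]
        simp [G, h1, h2]
      simp [h0, hω]
  have hE := P.expect_nonpos c hnp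
  have hEc : P.expect c = ∑ i, s i * (P ((X i).event ∩ (X i).cond) - L (X i) * P (X i).cond)
      - s₀ * (P (X₀.event ∩ X₀.cond) - L X₀ * P X₀.cond) - δ * P S := by
    simp only [c, map_sub, map_sum, map_smul, expect_gainCoeff, smul_eq_mul]
    simp [FinAddProb.expect]
  rw [hEc, heq, sub_self, mul_zero, sub_zero] at hE
  have hsum : 0 ≤ ∑ i, s i * (P ((X i).event ∩ (X i).cond) - L (X i) * P (X i).cond) :=
    Finset.sum_nonneg fun i _ => mul_nonneg (hs i) (sub_nonneg.2 (hle _ (hX i)))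
  have hPS : 0 < P S := by
    obtain ⟨ω, ⟨i, hi, -⟩ | ⟨h0, -⟩⟩ := hS
    · exact (hpos _ (hX i)).trans_le (P.mono fun ω hω => Or.inl ⟨i, hi, hω⟩)
    · exact (hpos _ hX₀).trans_le (P.mono fun ω hω => Or.inr ⟨h0, hω⟩)
  nlinarith

/-! ### The closed form and its coherence -/

open Classical in
/-- The conditional lower probability of the `ε`-contamination model. -/
noncomputable def contaminationCondLower (P₀ : FinAddProb Ω) (ε : ℝ) (X : CondEvent Ω) : ℝ :=
  if X.cond ⊆ X.event then 1
  else (1 - ε) * P₀ (X.event ∩ X.cond) / ((1 - ε) * P₀ X.cond + ε)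

theorem contaminationCondLower_univ (P₀ : FinAddProb Ω) (ε : ℝ) (A : Set Ω) :
    contaminationCondLower P₀ ε ⟨A, Set.univ⟩ = contaminationLower P₀ ε A := by
  simp [contaminationCondLower, contaminationLower, P₀.univ', Set.univ_subset_iff]

theorem contaminationCondLower_of_not_subset (P₀ : FinAddProb Ω) (ε : ℝ) {A B : Set Ω}
    (h : ¬ B ⊆ A) : contaminationCondLower P₀ ε ⟨A, B⟩ =
      (1 - ε) * P₀ (A ∩ B) / ((1 - ε) * P₀ B + ε) := if_neg h

/-- The point mass adds at least `0` to the numerator and at most `ε` to the denominator. -/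
theorem contaminationCondLower_mul_le (P₀ : FinAddProb Ω) {ε : ℝ} (hε₀ : 0 < ε) (hε₁ : ε < 1)
    (X : CondEvent Ω) (ω : Ω) :
    contaminationCondLower P₀ ε X * P₀.mixDirac ε hε₀.le hε₁.le ω X.cond ≤
      P₀.mixDirac ε hε₀.le hε₁.le ω (X.event ∩ X.cond) := by
  unfold contaminationCondLower
  split_ifs with h
  · rw [one_mul, Set.inter_eq_right.2 h]
  · have ha := mul_nonneg (sub_nonneg.2 hε₁.le) (P₀.nonneg' (X.event ∩ X.cond))
    have hd := mul_nonneg (sub_nonneg.2 hε₁.le) (P₀.nonneg' X.cond)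
    have h1 : X.cond.indicator (1 : Ω → ℝ) ω ≤ 1 :=
      Set.indicator_le_self' (fun _ _ => zero_le_one) ω
    have h2 : 0 ≤ (X.event ∩ X.cond).indicator (1 : Ω → ℝ) ω :=
      Set.indicator_nonneg (fun _ _ => zero_le_one) ω
    rw [FinAddProb.mixDirac_apply, FinAddProb.mixDirac_apply, div_mul_eq_mul_div]
    refine (div_le_of_le_mul₀ (by positivity) ha ?_).trans (le_add_of_nonneg_right (by positivity))
    exact mul_le_mul_of_nonneg_left (by nlinarith) ha

/-- The worst point mass sits where the conditioning event holds and the event fails, if there is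
such a point. -/
theorem exists_contaminationCondLower_mul_eq (P₀ : FinAddProb Ω) {ε : ℝ} (hε₀ : 0 < ε)
    (hε₁ : ε < 1) (X : CondEvent Ω) (hX : X.cond.Nonempty) :
    ∃ ω, P₀.mixDirac ε hε₀.le hε₁.le ω (X.event ∩ X.cond) =
      contaminationCondLower P₀ ε X * P₀.mixDirac ε hε₀.le hε₁.le ω X.cond := by
  unfold contaminationCondLower
  split_ifs with h
  · exact ⟨hX.some, by rw [one_mul, Set.inter_eq_right.2 h]⟩
  · obtain ⟨ω, hω, hω'⟩ := Set.not_subset.1 h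
    have hd := mul_nonneg (sub_nonneg.2 hε₁.le) (P₀.nonneg' X.cond)
    refine ⟨ω, ?_⟩
    have : (1 - ε) * P₀ X.cond + ε ≠ 0 := by positivity
    rw [FinAddProb.mixDirac_apply, FinAddProb.mixDirac_apply]
    simp [hω, hω', this]

theorem isCoherentExtension_contaminationCondLower (P₀ : FinAddProb Ω) {ε : ℝ} (hε₀ : 0 < ε)
    (hε₁ : ε < 1) {B : Set Ω} (hB : 0 < P₀ B) :
    IsCoherentExtension (contaminationLower P₀ ε) B (contaminationCondLower P₀ ε) := by
  have hcond : ∀ X ∈ unconditional Ω ∪ givenEvent B, 0 < P₀ X.cond := by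
    rintro X (hX | hX)
    · rw [show X.cond = Set.univ from hX, P₀.univ']
      exact one_pos
    · rwa [show X.cond = B from hX]
  refine ⟨wCoherent_of_envelope fun X₀ hX₀ => ?_, contaminationCondLower_univ P₀ ε⟩
  have hne : X₀.cond.Nonempty := by
    rw [Set.nonempty_iff_ne_empty]
    intro h
    have := hcond X₀ hX₀
    rw [h, P₀.empty] at this
    exact this.false
  obtain ⟨ω, hω⟩ := exists_contaminationCondLower_mul_eq P₀ hε₀ hε₁ X₀ hne
  refine ⟨P₀.mixDirac ε hε₀.le hε₁.le ω, fun X hX => ?_,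
    fun X _ => contaminationCondLower_mul_le P₀ hε₀ hε₁ X ω, hω⟩
  rw [FinAddProb.mixDirac_apply]
  exact add_pos_of_pos_of_nonneg (mul_pos (sub_pos.2 hε₁) (hcond X hX))
    (mul_nonneg hε₀.le (Set.indicator_nonneg (fun _ _ => zero_le_one) ω))

/-! ### Minimality of the closed form -/

/-- The gain from a single bet against an event of `D` is not uniformly negative on its
conditioning event. -/
theorem WCoherent.nonpos_of_le_gain {D : Set (CondEvent Ω)} {Q : CondEvent Ω → ℝ}
    (h : WCoherent D Q) {X : CondEvent Ω} (hX : X ∈ D) (hne : X.cond.Nonempty) {δ : ℝ}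
    (hδ : ∀ ω ∈ X.cond, δ ≤ gain X (Q X) ω) : δ ≤ 0 := by
  obtain ⟨ω₀, hω₀⟩ := hne
  have h1 := h 0 Fin.elim0 X Fin.elim0 1 (fun i => i.elim0) hX (fun i => i.elim0) zero_le_one
    ⟨ω₀, Or.inr ⟨one_ne_zero, hω₀⟩⟩
  have h2 := h1.trans (csSup_le (a := -δ) (Set.Nonempty.image _ ⟨ω₀, Or.inr ⟨one_ne_zero, hω₀⟩⟩) ?_)
  · linarith
  · rintro _ ⟨ω, ⟨i, -⟩ | ⟨-, hω⟩, rfl⟩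
    · exact i.elim0
    · have := hδ ω hω
      simpa using this

theorem WCoherent.nonneg {D : Set (CondEvent Ω)} {Q : CondEvent Ω → ℝ} (h : WCoherent D Q)
    {X : CondEvent Ω} (hX : X ∈ D) (hne : X.cond.Nonempty) : 0 ≤ Q X := by
  have := h.nonpos_of_le_gain hX hne (δ := -Q X) fun ω hω => by
    have : 0 ≤ X.event.indicator (1 : Ω → ℝ) ω :=
      Set.indicator_nonneg (fun _ _ => zero_le_one) ω
    simp only [gain, Set.indicator_of_mem hω, Pi.one_apply, one_mul]
    linarith
  linarith

theorem WCoherent.one_le_of_subset {D : Set (CondEvent Ω)} {Q : CondEvent Ω → ℝ}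
    (h : WCoherent D Q) {X : CondEvent Ω} (hX : X ∈ D) (hne : X.cond.Nonempty)
    (hsub : X.cond ⊆ X.event) : 1 ≤ Q X := by
  have := h.nonpos_of_le_gain hX hne (δ := 1 - Q X) fun ω hω => by
    simp [gain, Set.indicator_of_mem hω, Set.indicator_of_mem (hsub hω)]
  linarith

/-- The lower bound on a coherent conditional lower probability in terms of the unconditional one:
`u` is the upper probability of `B ∧ ¬ C`. -/
theorem WCoherent.le_mul_add {B C : Set Ω} {Q : CondEvent Ω → ℝ}
    (h : WCoherent (unconditional Ω ∪ givenEvent B) Q) (hB : B.Nonempty) {l u : ℝ}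
    (hl : Q ⟨C ∩ B, Set.univ⟩ = l) (hu : Q ⟨(B \ C)ᶜ, Set.univ⟩ = 1 - u) (hq : Q ⟨C, B⟩ < 1) :
    l ≤ Q ⟨C, B⟩ * (l + u) := by
  classical
  set q := Q ⟨C, B⟩ with hqdef
  have hq0 : 0 ≤ q := h.nonneg (Or.inr rfl) hB
  obtain ⟨ω₀, -⟩ := hB
  -- With stakes `1 - q` on `C ∩ B`, `q` on `(B \ C)ᶜ` and `1` against `C | B`, the total gain is `q
  -- (l + u) - l` at every point, on or off `B`.
  have hS : ∀ ω : Ω, (∃ i : Fin 2, (![1 - q, q] : Fin 2 → ℝ) i ≠ 0 ∧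
      ω ∈ ((![⟨C ∩ B, Set.univ⟩, ⟨(B \ C)ᶜ, Set.univ⟩] : Fin 2 → CondEvent Ω) i).cond) ∨
      ((1 : ℝ) ≠ 0 ∧ ω ∈ (⟨C, B⟩ : CondEvent Ω).cond) :=
    fun ω => Or.inl ⟨0, by simpa using (sub_pos.2 hq).ne', Set.mem_univ ω⟩
  have h1 := h 2 ![⟨C ∩ B, Set.univ⟩, ⟨(B \ C)ᶜ, Set.univ⟩] ⟨C, B⟩ ![1 - q, q] 1
    (by intro i; fin_cases i <;> exact Or.inl rfl) (Or.inr rfl)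
    (by intro i; fin_cases i; exacts [sub_nonneg.2 hq.le, hq0]) zero_le_one ⟨ω₀, hS ω₀⟩
  have h2 := h1.trans (csSup_le (a := q * (l + u) - l) (Set.Nonempty.image _ ⟨ω₀, hS ω₀⟩) ?_)
  · linarith
  · rintro _ ⟨ω, -, rfl⟩
    apply le_of_eq
    simp only [Fin.sum_univ_two, Matrix.cons_val_zero, Matrix.cons_val_one, hl, hu, ← hqdef]
    by_cases hωB : ω ∈ B <;> by_cases hωC : ω ∈ C <;>
      simp [gain, hωB, hωC] <;> ring

theorem isNaturalExtension_contaminationCondLower (P₀ : FinAddProb Ω) {ε : ℝ} (hε₀ : 0 < ε)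
    (hε₁ : ε < 1) {B : Set Ω} (hB : 0 < P₀ B) :
    IsNaturalExtension (contaminationLower P₀ ε) B (contaminationCondLower P₀ ε) := by
  refine ⟨isCoherentExtension_contaminationCondLower P₀ hε₀ hε₁ hB, ?_⟩
  have huncond : ∀ Q, IsCoherentExtension (contaminationLower P₀ ε) B Q → ∀ C,
      contaminationCondLower P₀ ε ⟨C, Set.univ⟩ ≤ Q ⟨C, Set.univ⟩ := fun Q hQ C => by
    rw [contaminationCondLower_univ, hQ.2]
  rintro Q hQ ⟨C, D⟩ (hX | hX) <;> obtain rfl : D = _ := hX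
  · exact huncond Q hQ C
  have hne : D.Nonempty := by
    rw [Set.nonempty_iff_ne_empty]
    rintro rfl
    exact hB.ne' P₀.empty
  by_cases hsub : D ⊆ C
  · rw [contaminationCondLower, if_pos hsub]
    exact hQ.1.one_le_of_subset (Or.inr rfl) hne hsub
  by_cases hD : D = Set.univ
  · subst hD
    exact huncond Q hQ C
  rw [contaminationCondLower_of_not_subset P₀ ε hsub]
  have ha := mul_nonneg (sub_nonneg.2 hε₁.le) (P₀.nonneg' (C ∩ D))
  have hd := mul_nonneg (sub_nonneg.2 hε₁.le) (P₀.nonneg' D)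
  have had := mul_le_mul_of_nonneg_left (P₀.mono (Set.inter_subset_right : C ∩ D ⊆ D))
    (sub_nonneg.2 hε₁.le)
  rw [div_le_iff₀ (by positivity)]
  -- The bets behind `le_mul_add` need `1 - q` as a stake; for `q ≥ 1` the bound is trivial, the
  -- quotient being at most `1`.
  rcases le_or_gt 1 (Q ⟨C, D⟩) with hq | hq
  · nlinarith
  have hl : Q ⟨C ∩ D, Set.univ⟩ = (1 - ε) * P₀ (C ∩ D) := by
    rw [hQ.2, contaminationLower, if_neg]
    exact fun h => hD (Set.univ_subset_iff.1 (h ▸ Set.inter_subset_right))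
  have hu : Q ⟨(D \ C)ᶜ, Set.univ⟩ = 1 - ((1 - ε) * P₀ (D \ C) + ε) := by
    rw [hQ.2, contaminationLower, if_neg, P₀.compl]
    · ring
    · rwa [Set.compl_univ_iff, Set.sdiff_eq_empty]
  have hadd := P₀.inter_add_compl_inter C D
  rw [Set.inter_comm Cᶜ D, ← Set.sdiff_eq] at hadd
  calc _ ≤ _ := hQ.1.le_mul_add hne hl hu hq
    _ = _ := by rw [← hadd]; ring

/-! ### From the closed form to the dilation criterion -/

theorem IsNaturalExtension.eq {L : Set Ω → ℝ} {B : Set Ω} {E E' : CondEvent Ω → ℝ}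
    (h : IsNaturalExtension L B E) (h' : IsNaturalExtension L B E') {X : CondEvent Ω}
    (hX : X ∈ unconditional Ω ∪ givenEvent B) : E X = E' X :=
  le_antisymm (h.2 _ h'.1 X hX) (h'.2 _ h.1 X hX)

/-- Conditioning on `B` does not raise the lower probability of `A` in the `ε`-contamination model
exactly when `A` and `B` are not too positively dependent. -/
theorem contaminationCondLower_le_iff (P₀ : FinAddProb Ω) {ε : ℝ} (hε₀ : 0 < ε) (hε₁ : ε < 1)
    {A B : Set Ω} (h : ¬ B ⊆ A) :
    contaminationCondLower P₀ ε ⟨A, B⟩ ≤ contaminationLower P₀ ε A ↔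
      P₀ (A ∩ B) - P₀ A * P₀ B ≤ ε * P₀ A * P₀ Bᶜ := by
  have hA : A ≠ Set.univ := fun hA => h (hA ▸ Set.subset_univ B)
  have hd := mul_nonneg (sub_nonneg.2 hε₁.le) (P₀.nonneg' B)
  rw [contaminationCondLower_of_not_subset P₀ ε h, contaminationLower, if_neg hA,
    div_le_iff₀ (by positivity), mul_assoc, mul_le_mul_iff_right₀ (sub_pos.2 hε₁), P₀.compl]
  constructor <;> intro h <;> linarith

theorem contaminationUpper_eq (P₀ : FinAddProb Ω) (ε : ℝ) (A : Set Ω) :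
    contaminationUpper P₀ ε A = 1 - contaminationLower P₀ ε Aᶜ := by
  rw [contaminationUpper, contaminationLower, P₀.compl]
  simp only [Set.compl_univ_iff]
  split_ifs <;> ring

end Dilation

theorem proposition6 {Ω : Type*} (P₀ : Dilation.FinAddProb Ω) (ε : ℝ) (hε₀ : 0 < ε) (hε₁ : ε < 1)
    (𝔅 : Set (Set Ω)) (h𝔅 : Setoid.IsPartition 𝔅) (A : Set Ω)
    (hext : ¬ Dilation.IsExtreme (Dilation.contaminationLower P₀ ε)
      (Dilation.contaminationUpper P₀ ε) A)
    (hind : Dilation.LogicallyIndependent A 𝔅)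
    (hpos : ∀ B ∈ 𝔅, 0 < P₀ (A ∩ B) ∧ 0 < P₀ (Aᶜ ∩ B)) :
    Dilation.WeaklyDilates (Dilation.contaminationLower P₀ ε)
        (Dilation.contaminationUpper P₀ ε) 𝔅 A ↔
      ∀ B ∈ 𝔅,
        -(ε * P₀ Aᶜ * P₀ Bᶜ) ≤ P₀ (A ∩ B) - P₀ A * P₀ B ∧
          P₀ (A ∩ B) - P₀ A * P₀ B ≤ ε * P₀ A * P₀ Bᶜ := by
  refine forall₂_congr fun B hB => ?_
  obtain ⟨hBA, hBA'⟩ := hind B hB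
  have hadd := P₀.inter_add_compl_inter A B
  have hcompl := P₀.compl A
  have hnat := Dilation.isNaturalExtension_contaminationCondLower P₀ hε₀ hε₁
    (B := B) (by linarith [hpos B hB])
  -- Replacing `A` by `Aᶜ` changes the sign of its covariance with `B`, so the lower bound is the
  -- upper bound for `Aᶜ`.
  have hneg : -(ε * P₀ Aᶜ * P₀ Bᶜ) ≤ P₀ (A ∩ B) - P₀ A * P₀ B ↔
      P₀ (Aᶜ ∩ B) - P₀ Aᶜ * P₀ B ≤ ε * P₀ Aᶜ * P₀ Bᶜ := by
    have : P₀ (Aᶜ ∩ B) - P₀ Aᶜ * P₀ B = -(P₀ (A ∩ B) - P₀ A * P₀ B) := by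
      rw [hcompl, ← hadd]; ring
    rw [this, neg_le]
  have hLU : Dilation.contaminationLower P₀ ε A ≤ Dilation.contaminationUpper P₀ ε A := by
    rw [Dilation.contaminationLower, Dilation.contaminationUpper, if_neg, if_neg]
    · linarith
    · rintro rfl
      exact hBA' (by simp)
    · rintro rfl
      exact hBA (Set.subset_univ B)
  rw [hneg, ← Dilation.contaminationCondLower_le_iff P₀ hε₀ hε₁ hBA,
    ← Dilation.contaminationCondLower_le_iff P₀ hε₀ hε₁ hBA']
  constructor
  · rintro ⟨E, hE, h1, -, h3⟩
    rw [hE.eq hnat (Or.inr rfl)] at h1 h3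
    rw [Dilation.contaminationUpper_eq] at h3
    exact ⟨by linarith, h1⟩
  · rintro ⟨h1, h2⟩
    refine ⟨_, hnat, h2, hLU, ?_⟩
    rw [Dilation.contaminationUpper_eq]
    linarith
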